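/- Let $n\ge 1$ and let $A\in\mathbb{C}^{n\times n}$ have index $k\ge 1$, where the index $\mathrm{Ind}(A)$ is the smallest integer $k\ge 0$ with $\operatorname{rk}(A^k)=\operatorname{rk}(A^{k+1})$. Let $A$ be written in a core EP decomposition $$A=U\begin{bmatrix}T&S\\0&N\end{bmatrix}U^*,$$ where $U\in\mathbb{C}^{n\times n}$ is unitary, $T\in\mathbb{C}^{t\times t}$ is nonsingular with $t=\operatorname{rk}(T)=\operatorname{rk}(A^k)$, $S\in\mathbb{C}^{t\times(n-t)}$, and $N\in\mathbb{C}^{(n-t)\times(n-t)}$ is nilpotent of index $k$. Put $\tilde T_k=\sum_{i=0}^{k-1}T^iSN^{k-1-i}$. Write $\mathcal R$ and $\mathcal N$ for range and null space. Let $A^\dagger$ be the Moore–Penrose inverse of $A$, and $A^d$ the Drazin inverse, that is, the unique matrix $X$ with $XAX=X$, $AX=XA$ and $XA^{k+1}=A^k$. Put $P_A=AA^\dagger$ and $Q_A=A^\dagger A$, and define - the core EP inverse $A^{\mathrm{core}}=A^k(A^{k+1})^\dagger$, - the DMP inverse $A^{d,\dagger}=A^dP_A$, - the CMP inverse $A^{c,\dagger}=Q_AA^{d,\dagger}$,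 - the MPCEP inverse $A^{\dagger,\mathrm{core}}=Q_AA^{\mathrm{core}}$, - the WG inverse $A^{\mathrm{w}}=(A^{\mathrm{core}})^2A$. Then the following conditions are equivalent: (a) $A$ is a WG matrix, i.e. $AA^{\mathrm{w}}=A^{\mathrm{w}}A$; (b) $A^{d,\dagger}=A^{\mathrm{core}}$; (c) $A^{\dagger,\mathrm{core}}=A^{c,\dagger}$; (d) $A^{\mathrm{core}}A^2=A^{\mathrm{core}}A^2A^{\mathrm{core}}A$; (e) $\mathcal R(N)\subseteq\mathcal N(\tilde T_k)$. -/

import Mathlib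

open scoped Matrix

namespace GenInv

section MoorePenrose

variable {m n : Type*} [Fintype m] [DecidableEq m] [Fintype n] [DecidableEq n]

/-- The four Penrose equations for `X` with respect to `A`. -/
structure IsMoorePenrose (A : Matrix m n ℂ) (X : Matrix n m ℂ) : Prop where
  inner : A * X * A = A
  outer : X * A * X = X
  left_hermitian : (A * X)ᴴ = A * X
  right_hermitian : (X * A)ᴴ = X * A

/-- If the range of `B` lies in that of `A`, then `B = A * C` for some `C`. -/
theorem exists_factor {l : Type*} [Fintype l] [DecidableEq l] (A : Matrix m n ℂ)
    (B : Matrix m l ℂ) (h : LinearMap.range B.mulVecLin ≤ LinearMap.range A.mulVecLin) :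
    ∃ C : Matrix n l ℂ, B = A * C := by
  have h1 : ∀ j : l, ∃ v : n → ℂ, A *ᵥ v = B.col j := by
    intro j
    have : B.col j ∈ LinearMap.range B.mulVecLin :=
      ⟨Pi.single j 1, by simp⟩
    obtain ⟨v, hv⟩ := h this
    exact ⟨v, by simpa using hv⟩
  choose v hv using h1
  refine ⟨Matrix.of fun i j => v j i, ?_⟩
  ext i j
  have := congrFun (hv j) i
  simpa [Matrix.mul_apply, Matrix.mulVec, dotProduct, Matrix.col] using this.symm

/-- If `A * C` has the same rank as `A`, then `A = (A * C) * D` for some `D`. -/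
theorem exists_factor_of_rank {l : Type*} [Fintype l] [DecidableEq l] (A : Matrix m n ℂ)
    (C : Matrix n l ℂ) (h : (A * C).rank = A.rank) : ∃ D : Matrix l n ℂ, A = A * C * D := by
  apply exists_factor
  apply le_of_eq
  symm
  apply Submodule.eq_of_le_of_finrank_eq
  · rw [Matrix.mulVecLin_mul]
    exact LinearMap.range_comp_le_range _ _
  · exact h

open scoped ComplexOrder in
/-- There is `W` with `A * W * A = A` and `A * W` Hermitian. -/
theorem exists_inner_left (A : Matrix m n ℂ) :
    ∃ W : Matrix n m ℂ, A * W * A = A ∧ (A * W)ᴴ = A * W := by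
  obtain ⟨W, hW⟩ := exists_factor_of_rank Aᴴ A
    (by rw [Matrix.rank_conjTranspose_mul_self, Matrix.rank_conjTranspose])
  have h1 : (A * W)ᴴ * A = A := by
    have := congrArg Matrix.conjTranspose hW
    simp only [Matrix.conjTranspose_mul, Matrix.conjTranspose_conjTranspose] at this
    rw [Matrix.conjTranspose_mul, Matrix.mul_assoc]
    exact this.symm
  have h2 : (A * W)ᴴ * (A * W) = A * W := by
    rw [← Matrix.mul_assoc, h1]
  have h3 : (A * W)ᴴ = A * W := by
    have := congrArg Matrix.conjTranspose h2
    rw [Matrix.conjTranspose_mul, Matrix.conjTranspose_conjTranspose, h2] at this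
    exact this.symm
  exact ⟨W, by rw [h3] at h1; exact h1, h3⟩

theorem exists_isMoorePenrose (A : Matrix m n ℂ) : ∃ X, IsMoorePenrose A X := by
  obtain ⟨W, hW, hW'⟩ := exists_inner_left A
  obtain ⟨V', hV, hV'⟩ := exists_inner_left Aᴴ
  have hVA : A * V'ᴴ * A = A := by
    have := congrArg Matrix.conjTranspose hV
    simpa [Matrix.mul_assoc] using this
  have hVh : (V'ᴴ * A)ᴴ = V'ᴴ * A := by
    have := congrArg Matrix.conjTranspose hV'
    simpa using this
  have e1 : A * (V'ᴴ * A * W) = A * W := by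
    rw [← Matrix.mul_assoc, ← Matrix.mul_assoc, hVA]
  have e2 : V'ᴴ * A * W * A = V'ᴴ * A := by
    rw [Matrix.mul_assoc, Matrix.mul_assoc, ← Matrix.mul_assoc A, hW]
  refine ⟨V'ᴴ * A * W, ?_, ?_, ?_, ?_⟩
  · rw [e1, hW]
  · rw [e2, Matrix.mul_assoc, e1, ← Matrix.mul_assoc]
  · rw [e1, hW']
  · rw [e2, hVh]

theorem IsMoorePenrose.unique {A : Matrix m n ℂ} {X Y : Matrix n m ℂ}
    (hX : IsMoorePenrose A X) (hY : IsMoorePenrose A Y) : X = Y := by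
  have h1 : A * X = A * Y := by
    calc A * X = (A * Y * A) * X := by rw [hY.inner]
      _ = (A * Y)ᴴ * (A * X)ᴴ := by
        rw [hY.left_hermitian, hX.left_hermitian, Matrix.mul_assoc]
      _ = (A * X * A * Y)ᴴ := by rw [← Matrix.conjTranspose_mul, ← Matrix.mul_assoc]
      _ = A * Y := by rw [hX.inner, hY.left_hermitian]
  have h2 : X * A = Y * A := by
    calc X * A = X * (A * Y * A) := by rw [hY.inner]
      _ = (X * A)ᴴ * (Y * A)ᴴ := by
        rw [hX.right_hermitian, hY.right_hermitian]; simp only [Matrix.mul_assoc]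
      _ = (Y * (A * X * A))ᴴ := by
        rw [← Matrix.conjTranspose_mul]; simp only [Matrix.mul_assoc]
      _ = Y * A := by rw [hX.inner, hY.right_hermitian]
  calc X = X * A * X := hX.outer.symm
    _ = Y * A * Y := by rw [h2, Matrix.mul_assoc, h1, ← Matrix.mul_assoc]
    _ = Y := hY.outer

/-- The Moore-Penrose inverse: the unique solution of the four Penrose equations. -/
noncomputable def moorePenrose (A : Matrix m n ℂ) : Matrix n m ℂ :=
  Classical.choose (exists_isMoorePenrose A)

theorem moorePenrose_spec (A : Matrix m n ℂ) : IsMoorePenrose A (moorePenrose A) :=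
  Classical.choose_spec (exists_isMoorePenrose A)

end MoorePenrose

section Square

variable {n : Type*} [Fintype n] [DecidableEq n]

/-- The index of `A`: the smallest `k ≥ 0` with `rk (A ^ k) = rk (A ^ (k + 1))`. -/
noncomputable def index (A : Matrix n n ℂ) : ℕ :=
  sInf {k : ℕ | (A ^ k).rank = (A ^ (k + 1)).rank}

theorem index_isLeast (A : Matrix n n ℂ) :
    IsLeast {k : ℕ | (A ^ k).rank = (A ^ (k + 1)).rank} (index A) := by
  have hne : {k : ℕ | (A ^ k).rank = (A ^ (k + 1)).rank}.Nonempty := by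
    by_contra hcon
    rw [Set.not_nonempty_iff_eq_empty] at hcon
    have hlt : ∀ k : ℕ, (A ^ (k + 1)).rank < (A ^ k).rank := by
      intro k
      refine lt_of_le_of_ne ?_ ?_
      · rw [pow_succ]
        exact Matrix.rank_mul_le_left _ _
      · intro h
        have : k ∈ {k : ℕ | (A ^ k).rank = (A ^ (k + 1)).rank} := h.symm
        rw [hcon] at this
        exact this
    have hb : ∀ k : ℕ, (A ^ k).rank + k ≤ (A ^ 0).rank := by
      intro k
      induction k with
      | zero => simp
      | succ k ih => have := hlt k; omega
    have := hb ((A ^ 0).rank + 1)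
    omega
  exact ⟨Nat.sInf_mem hne, fun _ h => Nat.sInf_le h⟩

/-- The equations of the Drazin inverse, where `k` is the index of `A`. -/
structure IsDrazin (A X : Matrix n n ℂ) : Prop where
  outer : X * A * X = X
  comm : A * X = X * A
  pow : X * A ^ (index A + 1) = A ^ index A

theorem exists_isDrazin (A : Matrix n n ℂ) : ∃ X, IsDrazin A X := by
  set k := index A with hk
  have hr : (A ^ k).rank = (A ^ (k + 1)).rank := (index_isLeast A).1
  have key : ∀ B : Matrix n n ℂ, (B ^ k).rank = (B ^ (k + 1)).rank →
      ∃ C, B ^ k = B ^ (2 * k + 1) * C := by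
    intro B hB
    obtain ⟨D, hD⟩ := exists_factor_of_rank (B ^ k) B (by rw [← pow_succ]; exact hB.symm)
    have hD' : B ^ k = B ^ (k + 1) * D := by rw [pow_succ]; exact hD
    have : ∀ j : ℕ, B ^ k = B ^ (k + j) * D ^ j := by
      intro j
      induction j with
      | zero => simp
      | succ j ih =>
        calc B ^ k = B ^ j * B ^ k * D ^ j := by rw [← pow_add, add_comm j k]; exact ih
          _ = B ^ j * (B ^ (k + 1) * D) * D ^ j := by rw [← hD']
          _ = B ^ (k + (j + 1)) * D ^ (j + 1) := by
            rw [pow_succ' D j, show k + (j + 1) = j + (k + 1) by omega, pow_add B j]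
            simp only [mul_assoc]
    exact ⟨D ^ (k + 1), by rw [show 2 * k + 1 = k + (k + 1) by omega]; exact this (k + 1)⟩
  obtain ⟨Y, hY⟩ := key A hr
  obtain ⟨Z', hZ'⟩ := key Aᵀ (by
    rw [← Matrix.transpose_pow, ← Matrix.transpose_pow, Matrix.rank_transpose,
      Matrix.rank_transpose]
    exact hr)
  have hZ : A ^ k = Z'ᵀ * A ^ (2 * k + 1) := by
    have := congrArg Matrix.transpose hZ'
    simpa [Matrix.transpose_mul, Matrix.transpose_pow] using this
  generalize Z'ᵀ = Z at hZ
  have e : A ^ k * Y = Z * A ^ k := by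
    calc A ^ k * Y = Z * A ^ (2 * k + 1) * Y := by rw [← hZ]
      _ = Z * A ^ k := by rw [mul_assoc, ← hY]
  refine ⟨A ^ k * Y, ?_, ?_, ?_⟩
  · calc A ^ k * Y * A * (A ^ k * Y) = Z * A ^ k * A * (A ^ k * Y) := by rw [e]
      _ = Z * A ^ (2 * k + 1) * Y := by
        rw [show 2 * k + 1 = k + 1 + k by omega, pow_add A (k + 1) k, pow_succ]
        simp only [mul_assoc]
      _ = A ^ k * Y := by rw [← hZ]
  · calc A * (A ^ k * Y) = A * (Z * A ^ (2 * k + 1)) * Y := by rw [← hZ, mul_assoc]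
      _ = A ^ k * A * Y := by
        rw [← hZ, ← pow_succ', ← pow_succ]
      _ = Z * (A * (A ^ (2 * k + 1) * Y)) := by
        rw [hZ]
        simp only [mul_assoc]
        rw [← mul_assoc (A ^ (2 * k + 1)) A Y, ← pow_succ, pow_succ', mul_assoc]
      _ = A ^ k * Y * A := by
        rw [← hY, e, ← pow_succ', pow_succ, mul_assoc]
  · rw [← hk, e, mul_assoc, ← pow_add, show k + (k + 1) = 2 * k + 1 by omega, ← hZ]

theorem IsDrazin.unique {A X Y : Matrix n n ℂ} (hX : IsDrazin A X) (hY : IsDrazin A Y) :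
    X = Y := by
  have hp : ∀ {W : Matrix n n ℂ}, IsDrazin A W → ∀ j : ℕ, W = W ^ (j + 1) * A ^ j := by
    intro W hW j
    have hc : Commute A W := hW.comm
    induction j with
    | zero => simp
    | succ j ih =>
      calc W = W * A * W := hW.outer.symm
        _ = W * A * (W ^ (j + 1) * A ^ j) := by rw [← ih]
        _ = W * (A * W ^ (j + 1)) * A ^ j := by simp only [mul_assoc]
        _ = W ^ (j + 1 + 1) * A ^ (j + 1) := by
          rw [(hc.pow_right (j + 1)).eq, pow_succ' W (j + 1), pow_succ' A j]
          simp only [mul_assoc]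
  have hcX : Commute A X := hX.comm
  have hcY : Commute A Y := hY.comm
  set k := index A with hk
  have h1 : X = X * A * Y := by
    calc X = X ^ (k + 1) * A ^ k := hp hX k
      _ = X ^ (k + 1) * (Y * A ^ (k + 1)) := by rw [hY.pow]
      _ = X ^ (k + 1) * A ^ k * (A * Y) := by
        rw [← (hcY.pow_left (k + 1)).eq, pow_succ A]
        simp only [mul_assoc]
      _ = X * A * Y := by rw [← hp hX k, mul_assoc]
  have h2 : Y = X * A * Y := by
    calc Y = Y ^ (k + 1) * A ^ k := hp hY k
      _ = A ^ k * Y ^ (k + 1) := ((hcY.pow_pow k (k + 1)).eq).symm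
      _ = X * A ^ (k + 1) * Y ^ (k + 1) := by rw [hX.pow]
      _ = X * A * (A ^ k * Y ^ (k + 1)) := by
        rw [pow_succ' A]
        simp only [mul_assoc]
      _ = X * A * Y := by rw [(hcY.pow_pow k (k + 1)).eq, ← hp hY k]
  rw [h1, ← h2]

/-- The Drazin inverse `A ^ d`. -/
noncomputable def drazin (A : Matrix n n ℂ) : Matrix n n ℂ :=
  Classical.choose (exists_isDrazin A)

theorem drazin_spec (A : Matrix n n ℂ) : IsDrazin A (drazin A) :=
  Classical.choose_spec (exists_isDrazin A)

/-- The orthogonal projector `P_A = A A^†` onto the range of `A`. -/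
noncomputable def projP (A : Matrix n n ℂ) : Matrix n n ℂ := A * moorePenrose A

/-- The orthogonal projector `Q_A = A^† A` onto the range of `Aᴴ`. -/
noncomputable def projQ (A : Matrix n n ℂ) : Matrix n n ℂ := moorePenrose A * A

/-- The core EP inverse `A ^ k (A ^ (k + 1))^†`, with `k` the index of `A`. -/
noncomputable def coreEP (A : Matrix n n ℂ) : Matrix n n ℂ :=
  A ^ index A * moorePenrose (A ^ (index A + 1))

/-- The DMP inverse `A^d P_A`. -/
noncomputable def dmp (A : Matrix n n ℂ) : Matrix n n ℂ := drazin A * projP A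

/-- The CMP inverse `Q_A A^{d,†}`, where `A^{d,†}` is the DMP inverse. -/
noncomputable def cmp (A : Matrix n n ℂ) : Matrix n n ℂ := projQ A * dmp A

/-- The MPCEP inverse: `Q_A` times the core EP inverse. -/
noncomputable def mpcep (A : Matrix n n ℂ) : Matrix n n ℂ := projQ A * coreEP A

/-- The weak group (WG) inverse: the square of the core EP inverse times `A`. -/
noncomputable def weakGroup (A : Matrix n n ℂ) : Matrix n n ℂ := coreEP A ^ 2 * A

/-- `A` is a WG matrix if it commutes with its WG inverse. -/
def IsWGMatrix (A : Matrix n n ℂ) : Prop := A * weakGroup A = weakGroup A * A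

end Square

section CoreEPDecomposition

variable {n t : ℕ}

/-- The `n × n` matrix with blocks `[T, S; 0, N]`, the first block having size `t ≤ n`. -/
def blockUpper (ht : t ≤ n) (T : Matrix (Fin t) (Fin t) ℂ) (S : Matrix (Fin t) (Fin (n - t)) ℂ)
    (N : Matrix (Fin (n - t)) (Fin (n - t)) ℂ) : Matrix (Fin n) (Fin n) ℂ :=
  let e : Fin t ⊕ Fin (n - t) ≃ Fin n :=
    finSumFinEquiv.trans (finCongr (Nat.add_sub_of_le ht))
  Matrix.reindex e e (Matrix.fromBlocks T S 0 N)

/-- `A = U [T, S; 0, N] Uᴴ` is a core EP decomposition of `A`: `U` is unitary, `T` is a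
nonsingular `t × t` matrix with `t = rk (A ^ k)`, and `N` is nilpotent of index `k`, where `k`
is the index of `A`. -/
structure IsCoreEPDecomposition (A : Matrix (Fin n) (Fin n) ℂ) (ht : t ≤ n)
    (U : Matrix (Fin n) (Fin n) ℂ) (T : Matrix (Fin t) (Fin t) ℂ)
    (S : Matrix (Fin t) (Fin (n - t)) ℂ) (N : Matrix (Fin (n - t)) (Fin (n - t)) ℂ) : Prop where
  unitary : U ∈ Matrix.unitaryGroup (Fin n) ℂ
  eq : A = U * blockUpper ht T S N * Uᴴ
  nonsingular : IsUnit T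
  rank_pow : t = (A ^ index A).rank
  nilpotent : N ^ index A = 0
  nilpotent_least : ∀ j < index A, N ^ j ≠ 0

/-- `T̃_m = ∑_{i=0}^{m-1} T^i S N^{m-1-i}`. -/
def tildeT (T : Matrix (Fin t) (Fin t) ℂ) (S : Matrix (Fin t) (Fin (n - t)) ℂ)
    (N : Matrix (Fin (n - t)) (Fin (n - t)) ℂ) (m : ℕ) : Matrix (Fin t) (Fin (n - t)) ℂ :=
  ∑ i ∈ Finset.range m, T ^ i * S * N ^ (m - 1 - i)

end CoreEPDecomposition

end GenInv

/-!
Write `C` for the core EP inverse of `A` and `D` for its Drazin inverse. The product `A C` is the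
orthogonal projector onto the range of `A ^ k`, and `C = D (A C)`. Both (a) and (d) unfold to
`C A² = A C A`, which is in turn equivalent to `C A = D A`: it gives `C A = D (C A) A`, hence
`C A = D ^ (k + 1) (C A) A ^ (k + 1)`, where `C A ^ (k + 1) = A ^ k`. Conditions (b) and (c) reduce
to `C A = D A` by cancelling `A†` and `Q_A`. Multiplied by `A ^ (k + 1)`, this equation becomes
`A ^ k (A C) A = A ^ (k + 1)`, whose two sides are, in the block basis, upper triangular with
off-diagonal blocks `T ^ k S` and `T̃_(k + 1) = T ^ k S + T̃_k N`.
-/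

namespace GenInv

theorem eq_pow_mul_mul_pow {M : Type*} [Monoid M] {a d x : M} (h : x = d * x * a) (j : ℕ) :
    x = d ^ j * x * a ^ j := by
  induction j with
  | zero => simp
  | succ j ih =>
    calc x = d ^ j * (d * x * a) * a ^ j := by rw [← h]; exact ih
      _ = d ^ (j + 1) * x * a ^ (j + 1) := by
        rw [pow_succ d, pow_succ' a]
        simp only [mul_assoc]

theorem range_mulVecLin_le_ker_mulVecLin_iff {R l m p : Type*} [CommSemiring R] [Fintype m]
    [Fintype p] (M : Matrix l m R) (N : Matrix m p R) :
    LinearMap.range N.mulVecLin ≤ LinearMap.ker M.mulVecLin ↔ M * N = 0 := by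
  classical
  rw [LinearMap.range_le_ker_iff, ← Matrix.mulVecLin_mul, ← Matrix.toLin'_apply',
    LinearEquiv.map_eq_zero_iff]

section Square

variable {n : Type*} [Fintype n] [DecidableEq n] (A : Matrix n n ℂ)

theorem isHermitian_projP : (projP A).IsHermitian := (moorePenrose_spec A).left_hermitian

theorem projP_mul_self : projP A * A = A := (moorePenrose_spec A).inner

variable {A} in
theorem eq_projP_of_isHermitian {E X : Matrix n n ℂ} (hE : E.IsHermitian) (hEA : E * A = A)
    (hAX : A * X = E) : E = projP A := by
  have hPE : projP A * E = E := by rw [← hAX, ← mul_assoc, projP_mul_self]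
  calc E = (projP A * E)ᴴ := by rw [hPE, hE.eq]
    _ = E * projP A := by rw [Matrix.conjTranspose_mul, hE.eq, (isHermitian_projP A).eq]
    _ = projP A := by rw [projP, ← mul_assoc, hEA]

theorem mul_projQ_self : A * projQ A = A := by
  rw [projQ, ← mul_assoc, (moorePenrose_spec A).inner]

theorem commute_drazin : Commute A (drazin A) := (drazin_spec A).comm

theorem drazin_mul_pow_index_succ : drazin A * A ^ (index A + 1) = A ^ index A :=
  (drazin_spec A).pow

theorem pow_index_succ_mul_drazin : A ^ (index A + 1) * drazin A = A ^ index A := by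
  rw [((commute_drazin A).pow_left _).eq, drazin_mul_pow_index_succ]

theorem drazin_mul_drazin_mul_self : drazin A * drazin A * A = drazin A := by
  rw [mul_assoc, ← (commute_drazin A).eq, ← mul_assoc, (drazin_spec A).outer]

theorem drazin_eq_drazin_pow_mul_pow (j : ℕ) : drazin A = drazin A ^ (j + 1) * A ^ j := by
  rw [pow_succ]
  exact eq_pow_mul_mul_pow (drazin_mul_drazin_mul_self A).symm j

theorem drazin_mul_self_eq_pow_mul_pow (j : ℕ) :
    drazin A * A = drazin A ^ (j + 1) * A ^ (j + 1) := by
  conv_lhs => rw [drazin_eq_drazin_pow_mul_pow A j]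
  rw [mul_assoc, ← pow_succ]

theorem mul_coreEP : A * coreEP A = projP (A ^ (index A + 1)) := by
  rw [coreEP, projP, ← mul_assoc, ← pow_succ']

theorem drazin_mul_mul_coreEP : drazin A * (A * coreEP A) = coreEP A := by
  rw [mul_coreEP, projP, ← mul_assoc, drazin_mul_pow_index_succ, coreEP]

theorem mul_coreEP_mul_drazin : A * coreEP A * drazin A = drazin A := by
  have h : drazin A = A ^ (index A + 1) * drazin A ^ (index A + 2) := by
    rw [((commute_drazin A).pow_pow _ _).eq]
    exact drazin_eq_drazin_pow_mul_pow A (index A + 1)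
  calc A * coreEP A * drazin A
      = projP (A ^ (index A + 1)) * A ^ (index A + 1) * drazin A ^ (index A + 2) := by
        rw [mul_coreEP, mul_assoc, ← h]
    _ = drazin A := by rw [projP_mul_self, ← h]

theorem coreEP_mul_pow_index_succ : coreEP A * A ^ (index A + 1) = A ^ index A := by
  rw [← drazin_mul_mul_coreEP, mul_coreEP, mul_assoc, projP_mul_self, drazin_mul_pow_index_succ]

theorem coreEP_mul_mul_coreEP : coreEP A * A * coreEP A = coreEP A := by
  calc coreEP A * A * coreEP A
      = coreEP A * A ^ (index A + 1) * moorePenrose (A ^ (index A + 1)) := by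
        rw [mul_assoc, mul_coreEP, projP, mul_assoc]
    _ = coreEP A := by rw [coreEP_mul_pow_index_succ, coreEP]

theorem mul_coreEP_mul_coreEP : A * coreEP A * coreEP A = coreEP A := by
  calc A * coreEP A * coreEP A = A * coreEP A * drazin A * (A * coreEP A) := by
        rw [mul_assoc (A * coreEP A), drazin_mul_mul_coreEP]
    _ = coreEP A := by rw [mul_coreEP_mul_drazin, drazin_mul_mul_coreEP]

theorem coreEP_mul_mul_drazin : coreEP A * A * drazin A = drazin A := by
  calc coreEP A * A * drazin A = drazin A * (A * coreEP A) * (drazin A * A) := by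
        rw [mul_assoc, (commute_drazin A).eq, drazin_mul_mul_coreEP]
    _ = drazin A * (A * coreEP A * drazin A) * A := by simp only [mul_assoc]
    _ = drazin A := by rw [mul_coreEP_mul_drazin, drazin_mul_drazin_mul_self]

theorem coreEP_mul_sq_mul_coreEP : coreEP A * A ^ 2 * coreEP A = A * coreEP A := by
  have h : A * coreEP A = drazin A * A * (A * coreEP A) := by
    conv_lhs => rw [← drazin_mul_mul_coreEP]
    rw [← mul_assoc, (commute_drazin A).eq]
  calc coreEP A * A ^ 2 * coreEP A = coreEP A * A * (A * coreEP A) := by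
        rw [sq]
        simp only [mul_assoc]
    _ = coreEP A * A * drazin A * (A * (A * coreEP A)) := by
        conv_lhs => rw [h]
        simp only [mul_assoc]
    _ = A * coreEP A := by rw [coreEP_mul_mul_drazin, ← mul_assoc, ← h]

theorem coreEP_mul_projP : coreEP A * projP A = coreEP A := by
  have h : A * coreEP A * projP A = A * coreEP A := by
    have hP : (A * coreEP A).IsHermitian := by
      rw [mul_coreEP]
      exact isHermitian_projP _
    calc A * coreEP A * projP A = (projP A * (A * coreEP A))ᴴ := by
          rw [Matrix.conjTranspose_mul, hP.eq, (isHermitian_projP A).eq]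
      _ = A * coreEP A := by rw [← mul_assoc, projP_mul_self, hP.eq]
  rw [← drazin_mul_mul_coreEP, mul_assoc, h]

theorem isWGMatrix_iff_coreEP_mul_sq_eq : IsWGMatrix A ↔ coreEP A * A ^ 2 = A * coreEP A * A := by
  have hl : A * weakGroup A = coreEP A * A := by
    rw [weakGroup, sq, ← mul_assoc, ← mul_assoc, mul_coreEP_mul_coreEP]
  have hr : weakGroup A * A = coreEP A * (coreEP A * A ^ 2) := by
    simp only [weakGroup, sq, mul_assoc]
  rw [IsWGMatrix, hl, hr]
  constructor
  · intro h
    rw [mul_assoc A, h, ← mul_assoc, ← mul_assoc, mul_coreEP_mul_coreEP]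
  · intro h
    rw [h, mul_assoc A, ← mul_assoc, ← mul_assoc, coreEP_mul_mul_coreEP]

theorem coreEP_mul_sq_eq_iff :
    coreEP A * A ^ 2 = A * coreEP A * A ↔ coreEP A * A = drazin A * A := by
  constructor
  · intro h
    have hC : coreEP A * A = drazin A * (coreEP A * A) * A := by
      rw [mul_assoc (drazin A), mul_assoc (coreEP A), ← sq, h, ← mul_assoc,
        drazin_mul_mul_coreEP]
    calc coreEP A * A
        = drazin A ^ (index A + 1) * (coreEP A * A ^ (index A + 1)) * A := by
          conv_lhs => rw [eq_pow_mul_mul_pow hC (index A + 1)]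
          simp only [mul_assoc, pow_mul_comm']
      _ = drazin A * A := by
          rw [coreEP_mul_pow_index_succ, ← drazin_eq_drazin_pow_mul_pow]
  · intro h
    rw [sq, ← mul_assoc, h, mul_assoc A, h, ← mul_assoc, (commute_drazin A).eq]

theorem dmp_eq_coreEP_iff : dmp A = coreEP A ↔ coreEP A * A = drazin A * A := by
  constructor
  · intro h
    rw [← h, dmp, mul_assoc, projP_mul_self]
  · intro h
    rw [dmp, projP, ← mul_assoc, ← h, mul_assoc, ← projP, coreEP_mul_projP]

theorem mpcep_eq_cmp_iff : mpcep A = cmp A ↔ dmp A = coreEP A := by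
  constructor
  · intro h
    have hQ (X : Matrix n n ℂ) : drazin A * A * (projQ A * X) = drazin A * (A * X) := by
      rw [← mul_assoc, mul_assoc (drazin A), mul_projQ_self, mul_assoc]
    calc dmp A = drazin A * (A * dmp A) := by
          simp only [dmp, ← mul_assoc, (drazin_spec A).outer]
      _ = drazin A * A * cmp A := by rw [cmp, hQ]
      _ = drazin A * (A * coreEP A) := by rw [← h, mpcep, hQ]
      _ = coreEP A := drazin_mul_mul_coreEP A
  · intro h
    rw [mpcep, cmp, h]

theorem coreEP_mul_self_eq_drazin_mul_self_iff :
    coreEP A * A = drazin A * A ↔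
      A ^ index A * (A * coreEP A) * A = A ^ (index A + 1) := by
  constructor
  · intro h
    rw [← mul_assoc, ← pow_succ, mul_assoc, h, ← mul_assoc, pow_index_succ_mul_drazin, ← pow_succ]
  · intro h
    calc coreEP A * A = drazin A * (A * coreEP A * A) := by
          rw [← mul_assoc, drazin_mul_mul_coreEP]
      _ = drazin A ^ (index A + 1) * (A ^ index A * (A * coreEP A) * A) := by
          conv_lhs => rw [drazin_eq_drazin_pow_mul_pow A (index A)]
          simp only [mul_assoc]
      _ = drazin A * A := by rw [h, ← drazin_mul_self_eq_pow_mul_pow]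

end Square

section CoreEPDecomposition

variable {n t : ℕ}

theorem tildeT_succ (T : Matrix (Fin t) (Fin t) ℂ) (S : Matrix (Fin t) (Fin (n - t)) ℂ)
    (N : Matrix (Fin (n - t)) (Fin (n - t)) ℂ) (m : ℕ) :
    tildeT T S N (m + 1) = T ^ m * S + tildeT T S N m * N := by
  have h : ∀ i ∈ Finset.range m, T ^ i * S * N ^ (m - i) = T ^ i * S * N ^ (m - 1 - i) * N := by
    intro i hi
    have him : m - i = m - 1 - i + 1 := by grind
    rw [him, pow_succ, Matrix.mul_assoc _ _ N]
  simp [tildeT, Finset.sum_range_succ, Matrix.sum_mul, Finset.sum_congr rfl h, add_comm]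

theorem fromBlocks_pow (T : Matrix (Fin t) (Fin t) ℂ) (S : Matrix (Fin t) (Fin (n - t)) ℂ)
    (N : Matrix (Fin (n - t)) (Fin (n - t)) ℂ) (m : ℕ) :
    Matrix.fromBlocks T S 0 N ^ m = Matrix.fromBlocks (T ^ m) (tildeT T S N m) 0 (N ^ m) := by
  induction m with
  | zero => simp [tildeT, Matrix.fromBlocks_one]
  | succ m ih => simp [pow_succ, ih, Matrix.fromBlocks_multiply, tildeT_succ]

/-- Reindexing of a block matrix followed by conjugation with the unitary `U`, as an isomorphism
of star algebras: it carries `[T, S; 0, N]` to `U [T, S; 0, N] Uᴴ`. -/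
noncomputable def blockConj (ht : t ≤ n) (U : Matrix.unitaryGroup (Fin n) ℂ) :
    Matrix (Fin t ⊕ Fin (n - t)) (Fin t ⊕ Fin (n - t)) ℂ ≃⋆ₐ[ℂ] Matrix (Fin n) (Fin n) ℂ :=
  (StarAlgEquiv.ofAlgEquiv (Matrix.reindexAlgEquiv ℂ ℂ
    (finSumFinEquiv.trans (finCongr (Nat.add_sub_of_le ht)))) fun _ => rfl).trans
    (Unitary.conjStarAlgAut ℂ _ U)

namespace IsCoreEPDecomposition

variable {A U : Matrix (Fin n) (Fin n) ℂ} {ht : t ≤ n} {T : Matrix (Fin t) (Fin t) ℂ}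
  {S : Matrix (Fin t) (Fin (n - t)) ℂ} {N : Matrix (Fin (n - t)) (Fin (n - t)) ℂ}

theorem blockConj_fromBlocks (hA : IsCoreEPDecomposition A ht U T S N) :
    blockConj ht ⟨U, hA.unitary⟩ (Matrix.fromBlocks T S 0 N) = A :=
  hA.eq.symm

theorem pow_eq_blockConj (hA : IsCoreEPDecomposition A ht U T S N) (m : ℕ) :
    A ^ m = blockConj ht ⟨U, hA.unitary⟩
      (Matrix.fromBlocks (T ^ m) (tildeT T S N m) 0 (N ^ m)) := by
  rw [← fromBlocks_pow, map_pow, hA.blockConj_fromBlocks]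

theorem mul_coreEP_eq_blockConj (hA : IsCoreEPDecomposition A ht U T S N) :
    A * coreEP A = blockConj ht ⟨U, hA.unitary⟩ (Matrix.fromBlocks 1 0 0 0) := by
  obtain ⟨V, hV⟩ := (hA.nonsingular.pow (index A + 1)).exists_right_inv
  have hN : N ^ (index A + 1) = 0 := by rw [pow_succ, hA.nilpotent, zero_mul]
  have hpow := hA.pow_eq_blockConj (index A + 1)
  set φ := blockConj ht ⟨U, hA.unitary⟩
  have hE : (φ (Matrix.fromBlocks 1 0 0 0)).IsHermitian := by
    rw [Matrix.IsHermitian, ← Matrix.star_eq_conjTranspose, ← map_star,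
      Matrix.star_eq_conjTranspose, Matrix.fromBlocks_conjTranspose]
    simp
  have hEA : φ (Matrix.fromBlocks 1 0 0 0) * A ^ (index A + 1) = A ^ (index A + 1) := by
    rw [hpow, hN, ← map_mul, Matrix.fromBlocks_multiply]
    simp
  have hAX : A ^ (index A + 1) * φ (Matrix.fromBlocks V 0 0 0) =
      φ (Matrix.fromBlocks 1 0 0 0) := by
    rw [hpow, hN, ← map_mul, Matrix.fromBlocks_multiply]
    simp [hV]
  rw [mul_coreEP, eq_projP_of_isHermitian hE hEA hAX]

theorem pow_mul_coreEP_mul_eq_iff (hA : IsCoreEPDecomposition A ht U T S N) :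
    A ^ index A * (A * coreEP A) * A = A ^ (index A + 1) ↔ tildeT T S N (index A) * N = 0 := by
  have hl : A ^ index A * (A * coreEP A) * A = blockConj ht ⟨U, hA.unitary⟩
      (Matrix.fromBlocks (T ^ (index A + 1)) (T ^ index A * S) 0 0) := by
    calc A ^ index A * (A * coreEP A) * A
        = blockConj ht ⟨U, hA.unitary⟩
            (Matrix.fromBlocks (T ^ index A) (tildeT T S N (index A)) 0 (N ^ index A) *
              Matrix.fromBlocks 1 0 0 0 * Matrix.fromBlocks T S 0 N) := by
          rw [map_mul, map_mul, hA.blockConj_fromBlocks, ← hA.mul_coreEP_eq_blockConj,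
            ← hA.pow_eq_blockConj]
      _ = _ := by simp [Matrix.fromBlocks_multiply, pow_succ]
  have hr : A ^ (index A + 1) = blockConj ht ⟨U, hA.unitary⟩ (Matrix.fromBlocks
      (T ^ (index A + 1)) (T ^ index A * S + tildeT T S N (index A) * N) 0 0) := by
    rw [hA.pow_eq_blockConj, tildeT_succ, pow_succ N, hA.nilpotent, zero_mul]
  rw [hl, hr, EmbeddingLike.apply_eq_iff_eq, Matrix.fromBlocks_inj]
  simp

end IsCoreEPDecomposition

end CoreEPDecomposition

end GenInv

theorem theorem4p4 (n t k : ℕ) (ht : t ≤ n) (A : Matrix (Fin n) (Fin n) ℂ)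
    (hk : GenInv.index A = k) (hk1 : 1 ≤ k)
    (U : Matrix (Fin n) (Fin n) ℂ) (T : Matrix (Fin t) (Fin t) ℂ)
    (S : Matrix (Fin t) (Fin (n - t)) ℂ) (N : Matrix (Fin (n - t)) (Fin (n - t)) ℂ)
    (hA : GenInv.IsCoreEPDecomposition A ht U T S N) :
    List.TFAE [
      GenInv.IsWGMatrix A,
      GenInv.dmp A = GenInv.coreEP A,
      GenInv.mpcep A = GenInv.cmp A,
      GenInv.coreEP A * A ^ 2 = GenInv.coreEP A * A ^ 2 * GenInv.coreEP A * A,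
      LinearMap.range N.mulVecLin ≤ LinearMap.ker (GenInv.tildeT T S N k).mulVecLin] := by
  subst hk
  rw [GenInv.isWGMatrix_iff_coreEP_mul_sq_eq, GenInv.mpcep_eq_cmp_iff,
    GenInv.dmp_eq_coreEP_iff, GenInv.coreEP_mul_sq_mul_coreEP, GenInv.coreEP_mul_sq_eq_iff,
    GenInv.range_mulVecLin_le_ker_mulVecLin_iff, ← hA.pow_mul_coreEP_mul_eq_iff,
    ← GenInv.coreEP_mul_self_eq_drazin_mul_self_iff]
  simp only [List.tfae_cons_self, List.tfae_singleton]
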